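/- Let $M(x)=(2\pi)^{-n/2}e^{-|x|^2/2}$ be the standard Gaussian density on $\mathbb R^n$; write also $M$ for the probability measure $M(x)\,dx$ and $\mathbb E_M[f]=\int f\,M(x)\,dx$. For the Young functions $\Phi(x)=\cosh x-1$ and $\Phi(y)=(\cosh-1)_*(y)=\int_0^{y}\sinh^{-1}(t)\,dt$ let $L^{\Phi}(M)$ be the Orlicz space of (classes modulo a.e. equality of) measurable $f:\mathbb R^n\to\mathbb R$ with $\mathbb E_M[\Phi(\alpha f)]<\infty$ for some $\alpha>0$, with the Luxemburg norm $\|f\|=\inf\{r>0:\mathbb E_M[\Phi(f/r)]\le 1\}$. Let $B_M=\{U\in L^{\cosh-1}(M):\mathbb E_M[U]=0\}$ with the induced norm, let $K_M(U)=\log\mathbb E_M[e^{U}]\in(-\infty,+\infty]$ for $U\in L^{\cosh-1}(M)$, and let $S_M$ be the interior in $B_M$ of $\{U\in B_M:K_M(U)<\infty\}$. Then $e_M(U)=e^{U-K_M(U)}$ belongs to $L^{(\cosh-1)_*}(M)$ for every $U\in S_M$, and the map $e_M:S_M\to L^{(\cosh-1)_*}(M)$ is continuously Fréchet differentiable: it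 is Fréchet differentiable at every $U\in S_M$, and the derivative $U\mapsto De_M(U)$ is continuous on $S_M$ for the operator norm of bounded linear maps $B_M\to L^{(\cosh-1)_*}(M)$. For $U\in S_M$, every $H\in B_M$ is integrable with respect to the measure $e_M(U)\cdot M$, and the derivative in the direction $H$ is $$d_H e_M(U)=e_M(U)\,\bigl(H-\mathbb E_{e_M(U)\cdot M}[H]\bigr).$$ The same holds when $B_M$ is replaced throughout by the whole space $L^{\cosh-1}(M)$, and $S_M$ by the interior in $L^{\cosh-1}(M)$ of $\{U\in L^{\cosh-1}(M):K_M(U)<\infty\}$. -/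

import Mathlib

open MeasureTheory

/-- A (finite) Young function on the real line: even, convex, vanishing exactly at `0`. -/
structure YoungFun where
  toFun : ℝ → ℝ
  convexOn' : ConvexOn ℝ Set.univ toFun
  even' : ∀ x, toFun (-x) = toFun x
  map_zero' : toFun 0 = 0
  pos' : ∀ x, x ≠ 0 → 0 < toFun x

namespace YoungFun

instance : CoeFun YoungFun (fun _ => ℝ → ℝ) := ⟨YoungFun.toFun⟩

theorem nonneg (Φ : YoungFun) (x : ℝ) : 0 ≤ Φ x := by
  by_cases h : x = 0
  · rw [h, Φ.map_zero']
  · exact (Φ.pos' x h).le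

theorem convex_ineq (Φ : YoungFun) (x y a b : ℝ) (ha : 0 ≤ a) (hb : 0 ≤ b) (hab : a + b = 1) :
    Φ (a * x + b * y) ≤ a * Φ x + b * Φ y := by
  have := Φ.convexOn'.2 (Set.mem_univ x) (Set.mem_univ y) ha hb hab
  simpa using this

theorem mul_le (Φ : YoungFun) (x t : ℝ) (h0 : 0 ≤ t) (h1 : t ≤ 1) : Φ (t * x) ≤ t * Φ x := by
  have := Φ.convex_ineq x 0 t (1 - t) h0 (by linarith) (by ring)
  simpa [Φ.map_zero'] using this

theorem apply_abs (Φ : YoungFun) (x : ℝ) : Φ |x| = Φ x := by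
  rcases abs_choice x with h | h <;> rw [h]
  exact Φ.even' x

theorem mono_abs (Φ : YoungFun) {x y : ℝ} (h : |x| ≤ |y|) : Φ x ≤ Φ y := by
  rw [← Φ.apply_abs x, ← Φ.apply_abs y]
  by_cases hy : |y| = 0
  · have hx : |x| = 0 := le_antisymm (h.trans hy.le) (abs_nonneg _)
    rw [hx, hy]
  · have hy' : 0 < |y| := lt_of_le_of_ne (abs_nonneg _) (Ne.symm hy)
    have h1 : |x| / |y| ≤ 1 := (div_le_one hy').2 h
    have h0 : 0 ≤ |x| / |y| := by positivity
    have := Φ.mul_le |y| (|x| / |y|) h0 h1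
    rw [div_mul_cancel₀ _ hy] at this
    nlinarith [Φ.nonneg |y|]

theorem continuous (Φ : YoungFun) : Continuous Φ := by
  have := Φ.convexOn'.continuousOn isOpen_univ
  exact continuousOn_univ.1 this

theorem measurable (Φ : YoungFun) : Measurable Φ := Φ.continuous.measurable

end YoungFun

section Orlicz

variable {Ω : Type*} [MeasurableSpace Ω]

/-- The modular `∫ Φ(f) dμ`, as an extended nonnegative real. -/
noncomputable def orliczModular (Φ : YoungFun) (μ : Measure Ω) (f : Ω →ₘ[μ] ℝ) : ENNReal :=
  ∫⁻ x, ENNReal.ofReal (Φ (f x)) ∂μ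

theorem orliczModular_zero (Φ : YoungFun) (μ : Measure Ω) :
    orliczModular Φ μ (0 : Ω →ₘ[μ] ℝ) = 0 := by
  unfold orliczModular
  rw [lintegral_congr_ae (g := fun _ => 0)]
  · simp
  · filter_upwards [AEEqFun.coeFn_zero (α := Ω) (μ := μ) (β := ℝ)] with x hx
    rw [hx]; simp [Φ.map_zero']

theorem orliczModular_mono (Φ : YoungFun) (μ : Measure Ω) {f g : Ω →ₘ[μ] ℝ}
    (h : ∀ᵐ x ∂μ, |f x| ≤ |g x|) : orliczModular Φ μ f ≤ orliczModular Φ μ g := by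
  refine lintegral_mono_ae ?_
  filter_upwards [h] with x hx
  exact ENNReal.ofReal_le_ofReal (Φ.mono_abs hx)

theorem orliczModular_convex (Φ : YoungFun) (μ : Measure Ω) (f g : Ω →ₘ[μ] ℝ) {a b : ℝ}
    (ha : 0 ≤ a) (hb : 0 ≤ b) (hab : a + b = 1) :
    orliczModular Φ μ (a • f + b • g) ≤
      ENNReal.ofReal a * orliczModular Φ μ f + ENNReal.ofReal b * orliczModular Φ μ g := by
  unfold orliczModular
  have hm : ∀ u : Ω →ₘ[μ] ℝ, Measurable fun x => ENNReal.ofReal (Φ (u x)) := fun u =>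
    (Φ.measurable.comp u.measurable).ennreal_ofReal
  rw [← lintegral_const_mul _ (hm f), ← lintegral_const_mul _ (hm g),
    ← lintegral_add_left ((hm f).const_mul _)]
  refine lintegral_mono_ae ?_
  filter_upwards [AEEqFun.coeFn_add (a • f) (b • g), AEEqFun.coeFn_smul a f,
    AEEqFun.coeFn_smul b g] with x h1 h2 h3
  rw [h1, Pi.add_apply, h2, h3, ← ENNReal.ofReal_mul ha, ← ENNReal.ofReal_mul hb,
    ← ENNReal.ofReal_add (mul_nonneg ha (Φ.nonneg _)) (mul_nonneg hb (Φ.nonneg _))]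
  exact ENNReal.ofReal_le_ofReal (Φ.convex_ineq _ _ a b ha hb hab)

theorem orliczModular_smul_le (Φ : YoungFun) (μ : Measure Ω) (f : Ω →ₘ[μ] ℝ) {t : ℝ}
    (h0 : 0 ≤ t) (h1 : t ≤ 1) :
    orliczModular Φ μ (t • f) ≤ ENNReal.ofReal t * orliczModular Φ μ f := by
  have := orliczModular_convex Φ μ f 0 h0 (sub_nonneg.2 h1) (by ring)
  simpa [orliczModular_zero] using this

theorem orliczModular_smul_mono (Φ : YoungFun) (μ : Measure Ω) (f : Ω →ₘ[μ] ℝ) {s t : ℝ}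
    (h : |s| ≤ |t|) : orliczModular Φ μ (s • f) ≤ orliczModular Φ μ (t • f) := by
  refine orliczModular_mono Φ μ ?_
  filter_upwards [AEEqFun.coeFn_smul s f, AEEqFun.coeFn_smul t f] with x h1 h2
  rw [h1, h2]
  simpa [abs_mul] using mul_le_mul_of_nonneg_right h (abs_nonneg (f x))

/-- The vector space of all (classes modulo a.e. equality of) measurable real functions `f`
such that `∫ Φ(α f) dμ < ∞` for some `α > 0`. -/
noncomputable def orliczSubmodule (Φ : YoungFun) (μ : Measure Ω) : Submodule ℝ (Ω →ₘ[μ] ℝ) where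
  carrier := {f | ∃ α : ℝ, 0 < α ∧ orliczModular Φ μ (α • f) < ⊤}
  zero_mem' := ⟨1, one_pos, by simp [orliczModular_zero]⟩
  add_mem' := by
    rintro f g ⟨α, hα, hf⟩ ⟨β, hβ, hg⟩
    refine ⟨min α β / 2, by positivity, ?_⟩
    have hm : 0 < min α β := lt_min hα hβ
    have e : (min α β / 2) • (f + g) =
        (1 / 2 : ℝ) • (min α β • f) + (1 / 2 : ℝ) • (min α β • g) := by
      rw [smul_add, smul_smul, smul_smul]
      congr 2 <;> ring
    rw [e]
    refine lt_of_le_of_lt (orliczModular_convex Φ μ _ _ (by norm_num) (by norm_num)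
      (by norm_num)) ?_
    refine ENNReal.add_lt_top.2 ⟨ENNReal.mul_lt_top ENNReal.ofReal_lt_top ?_,
      ENNReal.mul_lt_top ENNReal.ofReal_lt_top ?_⟩
    · refine lt_of_le_of_lt (orliczModular_smul_mono Φ μ f ?_) hf
      rw [abs_of_pos hm, abs_of_pos hα]; exact min_le_left _ _
    · refine lt_of_le_of_lt (orliczModular_smul_mono Φ μ g ?_) hg
      rw [abs_of_pos hm, abs_of_pos hβ]; exact min_le_right _ _
  smul_mem' := by
    rintro c f ⟨α, hα, hf⟩
    refine ⟨α / (|c| + 1), by positivity, lt_of_le_of_lt ?_ hf⟩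
    rw [smul_smul]
    refine orliczModular_smul_mono Φ μ f ?_
    rw [abs_mul, abs_of_pos (show 0 < α / (|c| + 1) by positivity), abs_of_pos hα,
      div_mul_eq_mul_div, div_le_iff₀ (by positivity)]
    nlinarith [abs_nonneg c]

/-- The Orlicz space `L^Φ(μ)`, to be normed by the Luxemburg norm. -/
def OrliczSpace (Φ : YoungFun) (μ : Measure Ω) : Type _ := orliczSubmodule Φ μ

namespace OrliczSpace

variable {Φ : YoungFun} {μ : Measure Ω}

noncomputable instance instAddCommGroup : AddCommGroup (OrliczSpace Φ μ) :=
  inferInstanceAs (AddCommGroup (orliczSubmodule Φ μ))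

noncomputable instance instModule : Module ℝ (OrliczSpace Φ μ) :=
  inferInstanceAs (Module ℝ (orliczSubmodule Φ μ))

/-- The underlying class of measurable functions. -/
def toFn (f : OrliczSpace Φ μ) : Ω →ₘ[μ] ℝ := Subtype.val f

theorem toFn_mem (f : OrliczSpace Φ μ) : f.toFn ∈ orliczSubmodule Φ μ := Subtype.property f

/-- An element of the Orlicz space from a class of functions and a proof of membership. -/
def mk (f : Ω →ₘ[μ] ℝ) (hf : f ∈ orliczSubmodule Φ μ) : OrliczSpace Φ μ := ⟨f, hf⟩

@[simp] theorem toFn_mk (f : Ω →ₘ[μ] ℝ) (hf : f ∈ orliczSubmodule Φ μ) :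
    (mk f hf).toFn = f := rfl

@[ext] theorem ext {f g : OrliczSpace Φ μ} (h : f.toFn = g.toFn) : f = g := Subtype.ext h

@[simp] theorem toFn_zero : (0 : OrliczSpace Φ μ).toFn = 0 := rfl

@[simp] theorem toFn_add (f g : OrliczSpace Φ μ) : (f + g).toFn = f.toFn + g.toFn := rfl

@[simp] theorem toFn_sub (f g : OrliczSpace Φ μ) : (f - g).toFn = f.toFn - g.toFn := rfl

@[simp] theorem toFn_neg (f : OrliczSpace Φ μ) : (-f).toFn = -f.toFn := rfl

@[simp] theorem toFn_smul (c : ℝ) (f : OrliczSpace Φ μ) : (c • f).toFn = c • f.toFn := rfl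

variable (Φ μ)

/-- The unit ball `{f | ∫ Φ(f) dμ ≤ 1}`. -/
def unitBall : Set (OrliczSpace Φ μ) := {f | orliczModular Φ μ f.toFn ≤ 1}

variable {Φ μ}

theorem mem_unitBall {f : OrliczSpace Φ μ} :
    f ∈ unitBall Φ μ ↔ orliczModular Φ μ f.toFn ≤ 1 := Iff.rfl

/-- The Luxemburg norm `inf {r > 0 | ∫ Φ(f / r) dμ ≤ 1}`, i.e. the gauge of the unit ball. -/
noncomputable instance instNorm : Norm (OrliczSpace Φ μ) :=
  ⟨fun f => sInf {r : ℝ | 0 < r ∧ orliczModular Φ μ (r⁻¹ • f.toFn) ≤ 1}⟩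

theorem norm_def (f : OrliczSpace Φ μ) :
    ‖f‖ = sInf {r : ℝ | 0 < r ∧ orliczModular Φ μ (r⁻¹ • f.toFn) ≤ 1} := rfl

theorem norm_eq_gauge (f : OrliczSpace Φ μ) : ‖f‖ = gauge (unitBall Φ μ) f := by
  rw [gauge_def']
  rfl

theorem convex_ball :
    Convex ℝ (unitBall Φ μ) := by
  intro f hf g hg a b ha hb hab
  simp only [mem_unitBall, toFn_add, toFn_smul] at hf hg ⊢
  refine (orliczModular_convex Φ μ _ _ ha hb hab).trans ?_
  calc ENNReal.ofReal a * orliczModular Φ μ f.toFn +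
        ENNReal.ofReal b * orliczModular Φ μ g.toFn
      ≤ ENNReal.ofReal a * 1 + ENNReal.ofReal b * 1 := by gcongr
    _ = 1 := by rw [mul_one, mul_one, ← ENNReal.ofReal_add ha hb, hab, ENNReal.ofReal_one]

theorem balanced_ball :
    Balanced ℝ (unitBall Φ μ) := by
  rw [balanced_iff_smul_mem]
  intro a ha f hf
  simp only [mem_unitBall, toFn_smul] at hf ⊢
  refine le_trans ?_ hf
  have := orliczModular_smul_mono Φ μ f.toFn (s := a) (t := 1) (by simpa using ha)
  simpa using this

theorem absorbent_ball :
    Absorbent ℝ (unitBall Φ μ) := by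
  refine absorbent_iff_eventually_nhdsNE_zero.2 ?_
  intro f
  obtain ⟨α, hα, hf⟩ := f.toFn_mem
  refine Filter.Eventually.filter_mono nhdsWithin_le_nhds ?_
  set R := (orliczModular Φ μ (α • f.toFn)).toReal with hR
  have hR0 : 0 ≤ R := ENNReal.toReal_nonneg
  have hpos : 0 < α / (R + 1) := by positivity
  filter_upwards [Metric.ball_mem_nhds (0 : ℝ) hpos] with c hc
  rw [mem_unitBall, toFn_smul]
  have hc' : |c| ≤ |(1 / (R + 1)) * α| := by
    rw [abs_of_pos (show 0 < (1 / (R + 1)) * α by positivity)]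
    have : |c| < α / (R + 1) := by simpa using hc
    calc |c| ≤ α / (R + 1) := this.le
      _ = _ := by ring
  refine (orliczModular_smul_mono Φ μ f.toFn hc').trans ?_
  rw [← smul_smul]
  refine (orliczModular_smul_le Φ μ _ (by positivity) ?_).trans ?_
  · rw [div_le_one (by positivity)]; linarith
  · rw [← ENNReal.ofReal_toReal hf.ne, ← hR, ← ENNReal.ofReal_mul (by positivity)]
    refine ENNReal.ofReal_le_one.2 ?_
    rw [one_div, inv_mul_le_iff₀ (by positivity)]
    linarith

theorem eq_zero_of_norm_eq_zero
    (f : OrliczSpace Φ μ) (h : ‖f‖ = 0) : f = 0 := by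
  rw [norm_eq_gauge] at h
  have hk : ∀ k : ℕ, orliczModular Φ μ (((k : ℝ) + 1) • f.toFn) ≤ 1 := by
    intro k
    have hlt : gauge (unitBall Φ μ) f <
        1 / ((k : ℝ) + 1) := by
      rw [h]; positivity
    obtain ⟨r, hr, hr1, hmem⟩ := exists_lt_of_gauge_lt absorbent_ball hlt
    rw [Set.mem_smul_set_iff_inv_smul_mem₀ hr.ne'] at hmem
    simp only [mem_unitBall, toFn_smul] at hmem
    refine (orliczModular_smul_mono Φ μ _ ?_).trans hmem
    rw [abs_of_pos (by positivity), abs_of_pos (by positivity), le_inv_comm₀ (by positivity) hr]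
    simpa using hr1.le
  have h2 : ∀ k : ℕ, orliczModular Φ μ f.toFn ≤ ENNReal.ofReal (1 / ((k : ℝ) + 1)) := by
    intro k
    have hk1 : (0 : ℝ) < (k : ℝ) + 1 := by positivity
    have e : f.toFn = (1 / ((k : ℝ) + 1)) • (((k : ℝ) + 1) • f.toFn) := by
      rw [smul_smul, one_div, inv_mul_cancel₀ hk1.ne', one_smul]
    rw [e]
    refine (orliczModular_smul_le Φ μ _ (by positivity) ?_).trans ?_
    · rw [div_le_one hk1]; linarith [(Nat.cast_nonneg k : (0 : ℝ) ≤ k)]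
    · calc _ ≤ ENNReal.ofReal (1 / ((k : ℝ) + 1)) * 1 := by gcongr; exact hk k
        _ = _ := mul_one _
  have h3 : orliczModular Φ μ f.toFn = 0 := by
    have ht := ENNReal.tendsto_ofReal (tendsto_one_div_add_atTop_nhds_zero_nat (𝕜 := ℝ))
    rw [ENNReal.ofReal_zero] at ht
    exact le_antisymm (ge_of_tendsto' ht h2) zero_le
  unfold orliczModular at h3
  have hm : Measurable fun x => ENNReal.ofReal (Φ (f.toFn x)) :=
    (Φ.measurable.comp f.toFn.measurable).ennreal_ofReal
  rw [lintegral_eq_zero_iff hm] at h3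
  refine OrliczSpace.ext (AEEqFun.ext ?_)
  filter_upwards [h3, AEEqFun.coeFn_zero (α := Ω) (μ := μ) (β := ℝ)] with x hx h0
  rw [toFn_zero, h0]
  by_contra hne
  have := Φ.pos' _ hne
  simp only [Pi.zero_apply, ENNReal.ofReal_eq_zero] at hx
  linarith

theorem normCore :
    NormedSpace.Core ℝ (OrliczSpace Φ μ) where
  norm_nonneg f := by
    rw [norm_eq_gauge]; exact gauge_nonneg _
  norm_smul c f := by
    rw [norm_eq_gauge, norm_eq_gauge]
    exact gauge_smul balanced_ball c f
  norm_triangle f g := by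
    simp only [norm_eq_gauge]
    exact gauge_add_le convex_ball absorbent_ball f g
  norm_eq_zero_iff f := by
    refine ⟨eq_zero_of_norm_eq_zero f, ?_⟩
    rintro rfl
    rw [norm_eq_gauge, gauge_zero]

noncomputable instance instNormedAddCommGroup :
    NormedAddCommGroup (OrliczSpace Φ μ) :=
  NormedAddCommGroup.ofCore normCore

noncomputable instance instNormedSpace :
    NormedSpace ℝ (OrliczSpace Φ μ) :=
  NormedSpace.ofCore normCore

end OrliczSpace

end Orlicz

/-- The Young function `cosh - 1`. -/
noncomputable def coshSubOne : YoungFun where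
  toFun x := Real.cosh x - 1
  convexOn' := by
    have h : ConvexOn ℝ Set.univ Real.cosh := by
      have h1 := convexOn_exp
      have h2 : ConvexOn ℝ Set.univ fun x : ℝ => Real.exp (-x) := by
        exact h1.comp_linearMap (-LinearMap.id)
      have h3 := (h1.add h2).smul (show (0 : ℝ) ≤ 1 / 2 by norm_num)
      refine h3.congr fun x _ => ?_
      simp only [Pi.add_apply, smul_eq_mul, Real.cosh_eq]
      ring
    exact h.add_const (-1)
  even' x := by rw [Real.cosh_neg]
  map_zero' := by simp
  pos' x hx := sub_pos.2 (Real.one_lt_cosh.2 hx)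

theorem hasDerivAt_integral_arsinh (y : ℝ) :
    HasDerivAt (fun y : ℝ => ∫ t in (0 : ℝ)..y, Real.arsinh t) (Real.arsinh y) y :=
  intervalIntegral.integral_hasDerivAt_right (Real.continuous_arsinh.intervalIntegrable _ _)
    (Real.continuous_arsinh.stronglyMeasurableAtFilter _ _) Real.continuous_arsinh.continuousAt

/-- The Young function `(cosh - 1)_*`, conjugate to `cosh - 1`:
`(cosh - 1)_*(y) = ∫₀^y sinh⁻¹(t) dt` (an even function of `y`, since `sinh⁻¹` is odd). -/
noncomputable def coshSubOneConj : YoungFun where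
  toFun y := ∫ t in (0 : ℝ)..y, Real.arsinh t
  convexOn' := by
    have hd : deriv (fun y : ℝ => ∫ t in (0 : ℝ)..y, Real.arsinh t) = Real.arsinh :=
      funext fun y => (hasDerivAt_integral_arsinh y).deriv
    refine MonotoneOn.convexOn_of_deriv convex_univ ?_ ?_ ?_
    · exact fun y _ => (hasDerivAt_integral_arsinh y).continuousAt.continuousWithinAt
    · exact fun y _ => (hasDerivAt_integral_arsinh y).differentiableAt.differentiableWithinAt
    · rw [hd]; exact Real.arsinh_strictMono.monotone.monotoneOn _
  even' y := by
    have := intervalIntegral.integral_comp_neg (a := y) (b := 0) Real.arsinh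
    simp only [Real.arsinh_neg, neg_zero, intervalIntegral.integral_neg] at this
    rw [← this, ← intervalIntegral.integral_symm y 0]
  map_zero' := by simp
  pos' y hy := by
    have hpos : ∀ z : ℝ, 0 < z → 0 < ∫ t in (0 : ℝ)..z, Real.arsinh t := fun z hz =>
      intervalIntegral.intervalIntegral_pos_of_pos_on
        (Real.continuous_arsinh.intervalIntegrable _ _)
        (fun t ht => Real.arsinh_pos_iff.2 ht.1) hz
    rcases lt_or_gt_of_ne hy with h | h
    · have := intervalIntegral.integral_comp_neg (a := y) (b := 0) Real.arsinh
      simp only [Real.arsinh_neg, neg_zero, intervalIntegral.integral_neg] at this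
      rw [intervalIntegral.integral_symm y 0, this]
      exact hpos _ (neg_pos.2 h)
    · exact hpos y h

section Gaussian

variable (n : ℕ)

/-- The standard Gaussian measure on `ℝⁿ`, of density `M(x) = (2π)^(-n/2) exp(-|x|²/2)`. -/
noncomputable def gaussM : Measure (EuclideanSpace ℝ (Fin n)) :=
  volume.withDensity fun x =>
    ENNReal.ofReal ((2 * Real.pi) ^ (-(n : ℝ) / 2) * Real.exp (-(1 / 2) * ‖x‖ ^ 2))

instance gaussM.instIsProbabilityMeasure : IsProbabilityMeasure (gaussM n) := by
  constructor
  have hI := GaussianFourier.integral_rexp_neg_mul_sq_norm (V := EuclideanSpace ℝ (Fin n))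
    (show (0 : ℝ) < 1 / 2 by norm_num)
  have hpos : (0 : ℝ) < (2 * Real.pi) ^ ((n : ℝ) / 2) := by positivity
  have hval : ∫ x : EuclideanSpace ℝ (Fin n), Real.exp (-(1 / 2) * ‖x‖ ^ 2) =
      (2 * Real.pi) ^ ((n : ℝ) / 2) := by
    rw [hI, finrank_euclideanSpace_fin]
    congr 1
    ring
  have hint : Integrable fun x : EuclideanSpace ℝ (Fin n) => Real.exp (-(1 / 2) * ‖x‖ ^ 2) := by
    by_contra h
    rw [integral_undef h] at hval
    linarith
  rw [gaussM, withDensity_apply _ MeasurableSet.univ, Measure.restrict_univ,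
    ← ofReal_integral_eq_lintegral_ofReal (hint.const_mul _)
      (Filter.Eventually.of_forall fun x => by positivity),
    integral_const_mul, hval, ← Real.rpow_add (by positivity)]
  simp [neg_div]

/-- The exponential space `L^{cosh - 1}(M)`. -/
abbrev LexpM : Type :=
  OrliczSpace coshSubOne (gaussM n)

/-- The mixture space `L^{(cosh - 1)_*}(M)`. -/
abbrev LlogLM : Type :=
  OrliczSpace coshSubOneConj (gaussM n)

theorem LexpM.integrable (U : LexpM n) :
    Integrable U.toFn (gaussM n) := by
  obtain ⟨α, hα, hf⟩ := U.toFn_mem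
  set f := U.toFn with hfU
  have hm : Measurable fun x => coshSubOne ((α • f : _ →ₘ[gaussM n] ℝ) x) :=
    coshSubOne.measurable.comp (AEEqFun.measurable _)
  have h1 : Integrable (fun x => coshSubOne ((α • f : _ →ₘ[gaussM n] ℝ) x)) (gaussM n) := by
    refine ⟨hm.aestronglyMeasurable, ?_⟩
    rw [hasFiniteIntegral_iff_ofReal (Filter.Eventually.of_forall fun x => coshSubOne.nonneg _)]
    exact hf
  have h2 := ((h1.add (integrable_const (1 : ℝ))).const_mul α⁻¹)
  refine h2.mono' f.aestronglyMeasurable ?_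
  filter_upwards [AEEqFun.coeFn_smul α f] with x hx
  have hb : |α * f x| ≤ Real.cosh (α * f x) := by
    rw [← Real.cosh_abs (α * f x)]
    exact (Real.self_le_sinh_iff.2 (abs_nonneg _)).trans (Real.sinh_lt_cosh _).le
  simp only [Pi.add_apply, hx, Pi.smul_apply, smul_eq_mul, coshSubOne, sub_add_cancel]
  rw [Real.norm_eq_abs, ← div_eq_inv_mul, le_div_iff₀ hα]
  rw [abs_mul, abs_of_pos hα] at hb
  linarith

/-- `B_M`, the subspace of the `U` in `L^{cosh - 1}(M)` with `E_M[U] = 0`. -/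
noncomputable def BM : Submodule ℝ (LexpM n) where
  carrier := {U | ∫ x, U.toFn x ∂gaussM n = 0}
  zero_mem' := by
    simp only [Set.mem_ofPred_eq, OrliczSpace.toFn_zero]
    rw [integral_congr_ae AEEqFun.coeFn_zero]
    simp
  add_mem' := by
    intro U V hU hV
    simp only [Set.mem_ofPred_eq, OrliczSpace.toFn_add] at hU hV ⊢
    rw [integral_congr_ae (AEEqFun.coeFn_add _ _)]
    simp only [Pi.add_apply]
    rw [integral_add (LexpM.integrable n U) (LexpM.integrable n V), hU, hV, add_zero]
  smul_mem' := by
    intro c U hU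
    simp only [Set.mem_ofPred_eq, OrliczSpace.toFn_smul] at hU ⊢
    rw [integral_congr_ae (AEEqFun.coeFn_smul _ _)]
    simp only [Pi.smul_apply]
    rw [integral_smul, hU, smul_zero]

variable {n}

/-- The partition functional `Z_M(U) = E_M[e^U] ∈ [0, ∞]`. -/
noncomputable def ZM (U : LexpM n) : ENNReal :=
  ∫⁻ x, ENNReal.ofReal (Real.exp (U.toFn x)) ∂gaussM n

/-- The cumulant functional `K_M(U) = log Z_M(U)`, an extended real number. -/
noncomputable def KM (U : LexpM n) : EReal := ENNReal.log (ZM U)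

/-- `e_M(U) = e^{U - K_M(U)}`, as a class of measurable functions (used where `K_M(U) < ∞`). -/
noncomputable def eM (U : LexpM n) : EuclideanSpace ℝ (Fin n) →ₘ[gaussM n] ℝ :=
  AEEqFun.comp (fun t : ℝ => Real.exp (t - (KM U).toReal)) (by fun_prop) U.toFn

/-- The measure `e_M(U) · M`. -/
noncomputable def eMMeasure (U : LexpM n) : Measure (EuclideanSpace ℝ (Fin n)) :=
  (gaussM n).withDensity fun x => ENNReal.ofReal (eM U x)

variable (n)

/-- `S_M`, the interior in `B_M` of the proper domain `{U ∈ B_M | K_M(U) < ∞}` of `K_M`. -/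
def SM : Set (BM n) := interior {U : BM n | KM (U : LexpM n) < ⊤}

/-- The interior in `L^{cosh - 1}(M)` of the domain of `K_M`, without the centering `E_M[U] = 0`. -/
def SMexp : Set (LexpM n) := interior {U : LexpM n | KM U < ⊤}

end Gaussian

/-!
Interior points are used only to gain integrability: if `U` is interior to the domain of `K_M`, then
`t U` still lies in the domain for some `t > 1`, so `e^{pU}` is integrable for some `p > 1`
(`OrliczSpace.expDomain`, `mem_expDomain_of_eventually`). From there on everything takes place on an
arbitrary probability space, and the centred case is the restriction of the uncentred one to `B_M`.

The key estimate is `OrliczSpace.exists_norm_mk_le_of_abs_le_exp`: if `e^{pU}` is integrable, there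
are `δ, C > 0` such that `|g| ≤ c e^{U + δ(|h| + |k|)}` with `h`, `k` in the open unit ball of
`L^{cosh - 1}` implies that `g` lies in `L^{(cosh - 1)_*}` with norm at most `c C`. Indeed
`(cosh - 1)_*` grows more slowly than `y ^ q` for every `q > 1`; for `1 < q < p` and `δ` small, the
exponent `q (U + δ(|h| + |k|))` is a convex combination of `pU`, `|h|` and `|k|`, and the integrals
of `e^{|h|}` and `e^{|k|}` are at most `4` on the unit ball.

Applied to `e^U H`, `e^U (e^K - 1 - K)` and `e^U (e^K - 1) H`, the estimate shows that multiplication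
by `e^U` is a bounded operator, that it is the Fréchet derivative of `U ↦ e^U`, with a quadratic
remainder, and that it depends on `U` continuously in operator norm. Since the integral is a
continuous linear functional on the mixture space (`OrliczSpace.integralCLM`), the normalized map
`U ↦ e^U / ∫ e^U` is continuously differentiable by the product rule, and its derivative takes the
stated covariance form (`OrliczSpace.coeFn_normExpMapDeriv`).
-/

/-! ### Elementary inequalities -/

theorem abs_exp_sub_one_le_abs_mul_exp (x : ℝ) :
    |Real.exp x - 1| ≤ |x| * Real.exp |x| := by
  have h1 := Real.add_one_le_exp x
  have h2 := Real.add_one_le_exp (-x)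
  have h3 : Real.exp x * Real.exp (-x) = 1 := by rw [← Real.exp_add]; simp
  rcases le_total 0 x with h | h
  · rw [abs_of_nonneg h, abs_of_nonneg (by linarith)]
    nlinarith [Real.exp_pos x]
  · rw [abs_of_nonpos h, abs_of_nonpos (by linarith [Real.exp_le_one_iff.2 h])]
    nlinarith

theorem abs_exp_sub_one_sub_le_sq_mul_exp (x : ℝ) :
    |Real.exp x - 1 - x| ≤ |x| ^ 2 * Real.exp |x| := by
  have h1 := Real.add_one_le_exp x
  have h2 := Real.add_one_le_exp (-x)
  have h3 : Real.exp x * Real.exp (-x) = 1 := by rw [← Real.exp_add]; simp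
  have h4 : Real.exp x - 1 ≤ x * Real.exp x := by nlinarith [Real.exp_pos x]
  rw [abs_of_nonneg (by linarith)]
  calc Real.exp x - 1 - x ≤ x * (Real.exp x - 1) := by linarith
    _ ≤ |x| * |Real.exp x - 1| := by rw [← abs_mul]; exact le_abs_self _
    _ ≤ |x| * (|x| * Real.exp |x|) := by gcongr; exact abs_exp_sub_one_le_abs_mul_exp x
    _ = _ := by ring

theorem le_inv_mul_exp_mul {d : ℝ} (hd : 0 < d) (x : ℝ) : x ≤ d⁻¹ * Real.exp (d * x) := by
  rw [← div_eq_inv_mul, le_div_iff₀ hd]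
  linarith [Real.add_one_le_exp (d * x)]

/-- The exponent on the left is dominated by a convex combination of `p a`, `b` and `c`, hence by
their maximum. This replaces Hölder's inequality throughout. -/
theorem exists_exp_mul_le_add {p : ℝ} (hp : 1 < p) :
    ∃ q δ : ℝ, 1 < q ∧ 0 < δ ∧ ∀ a b c : ℝ, Real.exp (q * (a + δ * (b + c))) ≤
      Real.exp (p * a) + Real.exp b + Real.exp c := by
  have hp0 : 0 < p := by linarith
  -- With `q = (1 + p) / 2`, the weights are `q / p` on `p a` and `q δ = (1 - q / p) / 2` on `b, c`.
  set θ : ℝ := (1 + p) / 2 / p with hθ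
  have hθp : θ * p = (1 + p) / 2 := by rw [hθ]; field_simp
  have hθ1 : θ < 1 := by rw [hθ, div_lt_one hp0]; linarith
  have hθ0 : 0 < θ := by rw [hθ]; positivity
  refine ⟨(1 + p) / 2, (1 - θ) / 2 / ((1 + p) / 2), by linarith, ?_, fun a b c => ?_⟩
  · have : 0 < 1 - θ := by linarith
    positivity
  have e : (1 + p) / 2 * (a + (1 - θ) / 2 / ((1 + p) / 2) * (b + c)) =
      θ * (p * a) + (1 - θ) / 2 * b + (1 - θ) / 2 * c := by
    rw [← mul_assoc θ, hθp]; field_simp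
    ring
  rw [e]
  have hm : θ * (p * a) + (1 - θ) / 2 * b + (1 - θ) / 2 * c ≤ max (p * a) (max b c) := by
    have h1 : p * a ≤ max (p * a) (max b c) := le_max_left _ _
    have h2 : b ≤ max (p * a) (max b c) := (le_max_left _ _).trans (le_max_right _ _)
    have h3 : c ≤ max (p * a) (max b c) := (le_max_right _ _).trans (le_max_right _ _)
    nlinarith
  refine (Real.exp_le_exp.2 hm).trans ?_
  have := Real.exp_pos (p * a)
  have := Real.exp_pos b
  have := Real.exp_pos c
  rcases max_choice (p * a) (max b c) with h | h
  · rw [h]; linarith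
  · rw [h]
    rcases max_choice b c with h | h <;> rw [h] <;> linarith

theorem coshSubOneConj_le_abs_mul_arsinh (y : ℝ) :
    coshSubOneConj y ≤ |y| * Real.arsinh |y| := by
  rw [← coshSubOneConj.apply_abs y]
  have h := intervalIntegral.integral_mono_on (μ := volume) (abs_nonneg y)
    (Real.continuous_arsinh.intervalIntegrable 0 |y|)
    (intervalIntegrable_const (c := Real.arsinh |y|))
    (fun x hx => Real.arsinh_le_arsinh.2 hx.2)
  rw [intervalIntegral.integral_const, sub_zero, smul_eq_mul] at h
  exact h

/-- `(cosh - 1)_*` grows more slowly than every power with exponent `q > 1`. -/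
theorem exists_coshSubOneConj_le {q : ℝ} (hq : 1 < q) :
    ∃ C : ℝ, 0 < C ∧ ∀ y s : ℝ, |y| ≤ Real.exp s →
      coshSubOneConj y ≤ C * (1 + Real.exp (q * s)) := by
  have ha : 0 < q - 1 := by linarith
  refine ⟨Real.exp (q * Real.log 3) / (q - 1), by positivity, fun y s hy => ?_⟩
  set t := |y| with ht
  have ht0 : 0 ≤ t := abs_nonneg y
  have h1 : Real.arsinh t ≤ (1 + 2 * t) ^ (q - 1) / (q - 1) := by
    refine le_trans ?_ (Real.log_le_rpow_div (by positivity) ha)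
    rw [Real.arsinh]
    refine Real.log_le_log (by positivity) ?_
    have : √(1 + t ^ 2) ≤ 1 + t := Real.sqrt_le_iff.2 ⟨by positivity, by nlinarith⟩
    linarith
  have h2 : (1 + 2 * t) ^ q ≤ Real.exp (q * Real.log 3) * (1 + Real.exp (q * s)) := by
    rw [Real.rpow_def_of_pos (by positivity), mul_comm _ q]
    rcases le_total 0 s with hs | hs
    · have h3 : Real.log (1 + 2 * t) ≤ Real.log 3 + s := by
        rw [Real.log_le_iff_le_exp (by positivity), Real.exp_add, Real.exp_log (by norm_num)]
        linarith [Real.one_le_exp hs]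
      calc Real.exp (q * Real.log (1 + 2 * t)) ≤ Real.exp (q * Real.log 3 + q * s) := by
            rw [← mul_add]; gcongr
        _ = Real.exp (q * Real.log 3) * Real.exp (q * s) := Real.exp_add _ _
        _ ≤ _ := by gcongr; linarith
    · have h3 : Real.log (1 + 2 * t) ≤ Real.log 3 := by
        refine Real.log_le_log (by positivity) ?_
        linarith [Real.exp_le_one_iff.2 hs]
      calc Real.exp (q * Real.log (1 + 2 * t)) ≤ Real.exp (q * Real.log 3) * 1 := by
            rw [mul_one]; gcongr
        _ ≤ _ := by gcongr; linarith [Real.exp_pos (q * s)]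
  calc coshSubOneConj y ≤ t * Real.arsinh t := coshSubOneConj_le_abs_mul_arsinh y
    _ ≤ (1 + 2 * t) * ((1 + 2 * t) ^ (q - 1) / (q - 1)) := by
        have := Real.arsinh_nonneg_iff.2 ht0
        gcongr
        linarith
    _ = (1 + 2 * t) ^ q / (q - 1) := by
        rw [Real.rpow_sub_one (by positivity)]; field_simp
    _ ≤ Real.exp (q * Real.log 3) * (1 + Real.exp (q * s)) / (q - 1) := by gcongr
    _ = _ := by ring

/-! ### Orlicz spaces over a measure -/

namespace OrliczSpace

variable {Ω : Type*} [MeasurableSpace Ω] {Φ : YoungFun} {μ : Measure Ω}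

theorem mem_unitBall_of_norm_lt_one {f : OrliczSpace Φ μ} (hf : ‖f‖ < 1) :
    f ∈ unitBall Φ μ := by
  refine setOfPred_gauge_lt_one_subset_self convex_ball ?_ absorbent_ball ?_
  · rw [mem_unitBall, toFn_zero, orliczModular_zero]; exact zero_le_one
  · rwa [norm_eq_gauge] at hf

/-- By convexity of the Young function, a modular bound `C ≥ 1` is a norm bound. -/
theorem exists_norm_mk_le {f : Ω →ₘ[μ] ℝ} {C : ℝ} (hC : 1 ≤ C)
    (hf : orliczModular Φ μ f ≤ ENNReal.ofReal C) :
    ∃ h : f ∈ orliczSubmodule Φ μ, ‖mk f h‖ ≤ C := by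
  have hC0 : 0 < C := by linarith
  refine ⟨⟨1, one_pos, ?_⟩, ?_⟩
  · rw [one_smul]; exact hf.trans_lt ENNReal.ofReal_lt_top
  · rw [norm_def]
    refine csInf_le ⟨0, fun r hr => hr.1.le⟩ ⟨hC0, ?_⟩
    refine (orliczModular_smul_le Φ μ _ (by positivity) (inv_le_one_of_one_le₀ hC)).trans ?_
    calc ENNReal.ofReal C⁻¹ * orliczModular Φ μ f
        ≤ ENNReal.ofReal C⁻¹ * ENNReal.ofReal C := by gcongr
      _ = 1 := by rw [← ENNReal.ofReal_mul (by positivity), inv_mul_cancel₀ hC0.ne',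
                    ENNReal.ofReal_one]

/-- Normalization into the open unit ball, uniform in `f` (including `f = 0`). The factor `2` leaves
room so that membership in `unitBall` needs no closedness argument. -/
theorem exists_eq_two_norm_smul (f : OrliczSpace Φ μ) :
    ∃ g : OrliczSpace Φ μ, ‖g‖ < 1 ∧ f = (2 * ‖f‖) • g := by
  by_cases hf : ‖f‖ = 0
  · exact ⟨0, by simp, by simpa using hf⟩
  · refine ⟨(2 * ‖f‖)⁻¹ • f, ?_, ?_⟩
    · rw [norm_smul, norm_inv, norm_mul, norm_norm, Real.norm_ofNat]
      field_simp
      norm_num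
    · rw [smul_smul, mul_inv_cancel₀ (by positivity), one_smul]

theorem integrable_comp_of_mem_unitBall {f : OrliczSpace Φ μ} (hf : f ∈ unitBall Φ μ) :
    Integrable (fun x => Φ (f.toFn x)) μ ∧ ∫ x, Φ (f.toFn x) ∂μ ≤ 1 := by
  have hm : Measurable fun x => Φ (f.toFn x) := Φ.measurable.comp f.toFn.measurable
  rw [mem_unitBall, orliczModular] at hf
  constructor
  · refine ⟨hm.aestronglyMeasurable, ?_⟩
    rw [hasFiniteIntegral_iff_ofReal (Filter.Eventually.of_forall fun x => Φ.nonneg _)]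
    exact hf.trans_lt ENNReal.one_lt_top
  · rw [integral_eq_lintegral_of_nonneg_ae (Filter.Eventually.of_forall fun x => Φ.nonneg _)
      hm.aestronglyMeasurable]
    exact ENNReal.toReal_le_of_le_ofReal zero_le_one (by simpa using hf)

/-- A Young function grows at least linearly away from the origin, so on a probability space every
Orlicz space sits continuously in `L¹`. -/
theorem integrable_and_abs_integral_le [IsProbabilityMeasure μ] (f : OrliczSpace Φ μ) :
    Integrable f.toFn μ ∧ |∫ x, f.toFn x ∂μ| ≤ 2 * (1 + (Φ 1)⁻¹) * ‖f‖ := by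
  have h1 : 0 < Φ 1 := Φ.pos' 1 one_ne_zero
  have key : ∀ y : ℝ, |y| ≤ 1 + (Φ 1)⁻¹ * Φ y := by
    intro y
    rcases le_total |y| 1 with h | h
    · have := mul_nonneg (inv_pos.2 h1).le (Φ.nonneg y)
      linarith
    · have hy : 0 < |y| := by linarith
      have := Φ.mul_le |y| |y|⁻¹ (by positivity) (inv_le_one_of_one_le₀ h)
      rw [inv_mul_cancel₀ hy.ne', Φ.apply_abs, inv_mul_eq_div, le_div_iff₀ hy] at this
      have : |y| ≤ (Φ 1)⁻¹ * Φ y := by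
        rw [inv_mul_eq_div, le_div_iff₀ h1]; linarith
      linarith
  have ball : ∀ g : OrliczSpace Φ μ, ‖g‖ < 1 →
      Integrable g.toFn μ ∧ |∫ x, g.toFn x ∂μ| ≤ 1 + (Φ 1)⁻¹ := by
    intro g hg
    obtain ⟨hi, hle⟩ := integrable_comp_of_mem_unitBall (mem_unitBall_of_norm_lt_one hg)
    have hI := (integrable_const (1 : ℝ)).add (hi.const_mul (Φ 1)⁻¹)
    have hg1 : Integrable g.toFn μ :=
      hI.mono' g.toFn.aestronglyMeasurable (Filter.Eventually.of_forall fun x => key _)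
    refine ⟨hg1, abs_integral_le_integral_abs.trans ?_⟩
    refine (integral_mono hg1.abs hI fun x => key _).trans ?_
    simp only [Pi.add_apply]
    rw [integral_add (integrable_const _) (hi.const_mul _), integral_const_mul]
    simp only [integral_const, probReal_univ, smul_eq_mul, mul_one]
    have := mul_le_mul_of_nonneg_left hle (inv_pos.2 h1).le
    linarith
  obtain ⟨g, hg, e⟩ := exists_eq_two_norm_smul f
  obtain ⟨hi, hle⟩ := ball g hg
  have hae : f.toFn =ᵐ[μ] fun x => (2 * ‖f‖) * g.toFn x := by
    have : f.toFn = (2 * ‖f‖) • g.toFn := by rw [← toFn_smul, ← e]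
    rw [this]
    filter_upwards [AEEqFun.coeFn_smul (2 * ‖f‖) g.toFn] with x hx
    simpa using hx
  refine ⟨(hi.const_mul _).congr hae.symm, ?_⟩
  rw [integral_congr_ae hae, integral_const_mul, abs_mul, abs_of_nonneg (by positivity)]
  nlinarith [norm_nonneg f]

/-- The integral as a continuous linear functional on an Orlicz space. -/
noncomputable def integralCLM (Φ : YoungFun) (μ : Measure Ω) [IsProbabilityMeasure μ] :
    OrliczSpace Φ μ →L[ℝ] ℝ :=
  LinearMap.mkContinuous
    { toFun := fun f => ∫ x, f.toFn x ∂μ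
      map_add' := fun f g => by
        rw [← integral_add (integrable_and_abs_integral_le f).1
          (integrable_and_abs_integral_le g).1]
        exact integral_congr_ae (AEEqFun.coeFn_add _ _)
      map_smul' := fun c f => by
        rw [RingHom.id_apply, ← integral_smul]
        exact integral_congr_ae (AEEqFun.coeFn_smul _ _) }
    (2 * (1 + (Φ 1)⁻¹)) (fun f => (integrable_and_abs_integral_le f).2)

@[simp] theorem integralCLM_apply [IsProbabilityMeasure μ] (f : OrliczSpace Φ μ) :
    integralCLM Φ μ f = ∫ x, f.toFn x ∂μ := rfl

theorem integral_exp_abs_le [IsProbabilityMeasure μ] {h : OrliczSpace coshSubOne μ}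
    (hh : ‖h‖ < 1) :
    Integrable (fun x => Real.exp |h.toFn x|) μ ∧ ∫ x, Real.exp |h.toFn x| ∂μ ≤ 4 := by
  obtain ⟨hi, hle⟩ := integrable_comp_of_mem_unitBall (mem_unitBall_of_norm_lt_one hh)
  have hb : ∀ y : ℝ, Real.exp |y| ≤ 2 * (coshSubOne y + 1) := by
    intro y
    have : coshSubOne y + 1 = Real.cosh |y| := by
      rw [Real.cosh_abs]; exact sub_add_cancel _ _
    rw [this, Real.cosh_eq]
    linarith [Real.exp_pos (-|y|)]
  have hI := (hi.add (integrable_const (1 : ℝ))).const_mul 2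
  have hE : Integrable (fun x => Real.exp |h.toFn x|) μ := by
    refine hI.mono' (by have := h.toFn.measurable; fun_prop) ?_
    refine Filter.Eventually.of_forall fun x => ?_
    rw [Real.norm_eq_abs, Real.abs_exp]
    exact hb _
  refine ⟨hE, (integral_mono hE hI fun x => hb _).trans ?_⟩
  simp only [Pi.add_apply]
  rw [integral_const_mul, integral_add hi (integrable_const _)]
  simp only [integral_const, probReal_univ, smul_eq_mul, mul_one]
  linarith

end OrliczSpace

/-! ### The exponential map into the mixture space -/

namespace OrliczSpace

variable {Ω : Type*} [MeasurableSpace Ω] {μ : Measure Ω}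

variable (μ) in
/-- The `U` in the exponential Orlicz space such that `e^{pU}` is integrable for some `p > 1`. -/
def expDomain : Set (OrliczSpace coshSubOne μ) :=
  {U | ∃ p : ℝ, 1 < p ∧ Integrable (fun x => Real.exp (p * U.toFn x)) μ}

/-- The class of `e^U`. -/
noncomputable def expFn (U : OrliczSpace coshSubOne μ) : Ω →ₘ[μ] ℝ :=
  AEEqFun.comp Real.exp Real.continuous_exp U.toFn

theorem coeFn_expFn (U : OrliczSpace coshSubOne μ) :
    expFn U =ᵐ[μ] fun x => Real.exp (U.toFn x) :=
  AEEqFun.coeFn_comp _ _ _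

theorem coeFn_toFn_smul {Φ : YoungFun} (c : ℝ) (f : OrliczSpace Φ μ) :
    (c • f).toFn =ᵐ[μ] fun x => c * f.toFn x := by
  rw [toFn_smul]; exact AEEqFun.coeFn_smul c f.toFn

theorem coeFn_toFn_add {Φ : YoungFun} (f g : OrliczSpace Φ μ) :
    (f + g).toFn =ᵐ[μ] fun x => f.toFn x + g.toFn x := by
  rw [toFn_add]; exact AEEqFun.coeFn_add f.toFn g.toFn

theorem coeFn_toFn_sub {Φ : YoungFun} (f g : OrliczSpace Φ μ) :
    (f - g).toFn =ᵐ[μ] fun x => f.toFn x - g.toFn x := by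
  rw [toFn_sub]; exact AEEqFun.coeFn_sub f.toFn g.toFn

/-- The estimate behind every membership and norm bound below: on the open unit ball of the
exponential space, multiples of `e^U` by functions of exponential growth `δ` lie in a fixed ball of
the mixture space. -/
theorem exists_norm_mk_le_of_abs_le_exp [IsProbabilityMeasure μ]
    {U : OrliczSpace coshSubOne μ} (hU : U ∈ expDomain μ) :
    ∃ δ C : ℝ, 0 < δ ∧ 0 < C ∧ ∀ h k : OrliczSpace coshSubOne μ, ‖h‖ < 1 → ‖k‖ < 1 →
      ∀ c : ℝ, 0 ≤ c → ∀ g : Ω →ₘ[μ] ℝ,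
        (∀ᵐ x ∂μ, |g x| ≤ c * Real.exp (U.toFn x + δ * (|h.toFn x| + |k.toFn x|))) →
        ∃ hg : g ∈ orliczSubmodule coshSubOneConj μ, ‖mk g hg‖ ≤ c * C := by
  obtain ⟨p, hp, hpI⟩ := hU
  obtain ⟨q, δ, hq, hδ, hexp⟩ := exists_exp_mul_le_add hp
  obtain ⟨B, hB, hΦ⟩ := exists_coshSubOneConj_le hq
  set I := ∫ x, Real.exp (p * U.toFn x) ∂μ with hI
  have hI0 : 0 ≤ I := integral_nonneg fun x => (Real.exp_pos _).le
  set C := max 1 (B * (1 + (I + 4 + 4))) with hC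
  have hC1 : 1 ≤ C := le_max_left _ _
  refine ⟨δ, C, hδ, by linarith, ?_⟩
  intro h k hh hk
  obtain ⟨hhI, hhle⟩ := integral_exp_abs_le hh
  obtain ⟨hkI, hkle⟩ := integral_exp_abs_le hk
  have normalized : ∀ g : Ω →ₘ[μ] ℝ,
      (∀ᵐ x ∂μ, |g x| ≤ Real.exp (U.toFn x + δ * (|h.toFn x| + |k.toFn x|))) →
      ∃ hg : g ∈ orliczSubmodule coshSubOneConj μ, ‖mk g hg‖ ≤ C := by
    intro g hg
    refine exists_norm_mk_le hC1 ?_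
    have hphI : Integrable (fun x => Real.exp (p * U.toFn x) + Real.exp |h.toFn x|) μ :=
      hpI.add hhI
    have hsum : Integrable (fun x => Real.exp (p * U.toFn x) + Real.exp |h.toFn x| +
        Real.exp |k.toFn x|) μ := hphI.add hkI
    have hint : Integrable (fun x => B * ((1 : ℝ) + (Real.exp (p * U.toFn x) +
        Real.exp |h.toFn x| + Real.exp |k.toFn x|))) μ :=
      ((integrable_const (1 : ℝ)).add hsum).const_mul B
    have hval : ∫ x, B * ((1 : ℝ) + (Real.exp (p * U.toFn x) + Real.exp |h.toFn x| +
        Real.exp |k.toFn x|)) ∂μ ≤ C := by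
      rw [integral_const_mul, integral_add (integrable_const _) hsum,
        integral_add hphI hkI, integral_add hpI hhI]
      simp only [integral_const, probReal_univ, smul_eq_mul, mul_one]
      refine le_trans ?_ (le_max_right _ _)
      gcongr
    refine le_trans ?_ (ENNReal.ofReal_le_ofReal hval)
    rw [ofReal_integral_eq_lintegral_ofReal hint
      (Filter.Eventually.of_forall fun x => by positivity)]
    refine lintegral_mono_ae ?_
    filter_upwards [hg] with x hx
    refine ENNReal.ofReal_le_ofReal ((hΦ _ _ hx).trans ?_)
    gcongr
    exact hexp _ _ _
  intro c hc g hg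
  have hg' : ∀ᵐ x ∂μ, |(c⁻¹ • g : Ω →ₘ[μ] ℝ) x| ≤
      Real.exp (U.toFn x + δ * (|h.toFn x| + |k.toFn x|)) := by
    filter_upwards [hg, AEEqFun.coeFn_smul c⁻¹ g] with x hx hs
    rw [hs, Pi.smul_apply, smul_eq_mul, abs_mul, abs_of_nonneg (inv_nonneg.2 hc)]
    rcases hc.eq_or_lt with rfl | hc
    · simp only [inv_zero, zero_mul]; positivity
    · rw [inv_mul_le_iff₀ hc]; exact hx
  obtain ⟨hm, hle⟩ := normalized _ hg'
  have e : g = c • (c⁻¹ • g) := by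
    rcases hc.eq_or_lt with rfl | hc
    · rw [zero_smul]
      refine AEEqFun.ext ?_
      filter_upwards [hg, AEEqFun.coeFn_zero (α := Ω) (μ := μ) (β := ℝ)] with x hx h0
      rw [h0]
      simpa using hx
    · rw [smul_smul, mul_inv_cancel₀ hc.ne', one_smul]
  have hgm : g ∈ orliczSubmodule coshSubOneConj μ := by
    rw [e]; exact Submodule.smul_mem _ _ hm
  refine ⟨hgm, ?_⟩
  have e' : mk g hgm = c • mk (c⁻¹ • g) hm := OrliczSpace.ext e
  rw [e', norm_smul, Real.norm_eq_abs, abs_of_nonneg hc]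
  gcongr

theorem expDomain_mem_nhds [IsProbabilityMeasure μ] {U : OrliczSpace coshSubOne μ}
    (hU : U ∈ expDomain μ) : expDomain μ ∈ nhds U := by
  obtain ⟨p, hp, hpI⟩ := hU
  obtain ⟨q, δ, hq, hδ, hexp⟩ := exists_exp_mul_le_add hp
  filter_upwards [Metric.ball_mem_nhds U hδ] with V hV
  obtain ⟨k, hk, e⟩ := exists_eq_two_norm_smul (V - U)
  obtain ⟨hkI, -⟩ := integral_exp_abs_le hk
  have hn : ‖V - U‖ < δ := by rwa [← dist_eq_norm]
  refine ⟨q, hq, ((hpI.add hkI).add hkI).mono'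
    (by have := V.toFn.measurable; fun_prop) ?_⟩
  have e2 : V = U + (2 * ‖V - U‖) • k := by rw [← e]; abel
  have h1 := coeFn_toFn_add U ((2 * ‖V - U‖) • k)
  rw [← e2] at h1
  filter_upwards [h1, coeFn_toFn_smul (2 * ‖V - U‖) k] with x h1 h2
  rw [Real.norm_eq_abs, Real.abs_exp]
  refine le_trans (Real.exp_le_exp.2 ?_) (hexp (U.toFn x) |k.toFn x| |k.toFn x|)
  rw [h1, h2]
  have : ‖V - U‖ * k.toFn x ≤ δ * |k.toFn x| :=
    (mul_le_mul_of_nonneg_left (le_abs_self _) (norm_nonneg _)).trans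
      (mul_le_mul_of_nonneg_right hn.le (abs_nonneg _))
  refine mul_le_mul_of_nonneg_left ?_ (by linarith)
  linarith

/-- Multiplication by `e^U`, as a bounded operator from the exponential to the mixture space. -/
theorem exists_mulExp [IsProbabilityMeasure μ] {U : OrliczSpace coshSubOne μ}
    (hU : U ∈ expDomain μ) :
    ∃ A : OrliczSpace coshSubOne μ →L[ℝ] OrliczSpace coshSubOneConj μ,
      ∀ H, (A H).toFn = expFn U * H.toFn := by
  obtain ⟨δ, C, hδ, hC, hmain⟩ := exists_norm_mk_le_of_abs_le_exp hU
  have key : ∀ H : OrliczSpace coshSubOne μ,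
      ∃ hg : expFn U * H.toFn ∈ orliczSubmodule coshSubOneConj μ,
        ‖mk _ hg‖ ≤ 2 * δ⁻¹ * C * ‖H‖ := by
    intro H
    obtain ⟨h, hh, e⟩ := exists_eq_two_norm_smul H
    have hs := coeFn_toFn_smul (2 * ‖H‖) h
    rw [← e] at hs
    obtain ⟨hg, hle⟩ := hmain h 0 hh (by simp) (2 * ‖H‖ * δ⁻¹) (by positivity)
      (expFn U * H.toFn) (by
        filter_upwards [AEEqFun.coeFn_mul (expFn U) H.toFn, coeFn_expFn U, hs] with x h1 h2 h3
        rw [h1, Pi.mul_apply, h2, h3, abs_mul, Real.abs_exp, abs_mul,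
          abs_of_nonneg (show 0 ≤ 2 * ‖H‖ by positivity), Real.exp_add]
        calc Real.exp (U.toFn x) * (2 * ‖H‖ * |h.toFn x|)
            ≤ Real.exp (U.toFn x) * (2 * ‖H‖ * (δ⁻¹ * Real.exp (δ * (|h.toFn x| +
              |(0 : OrliczSpace coshSubOne μ).toFn x|)))) := by
              gcongr
              refine (le_inv_mul_exp_mul hδ _).trans ?_
              gcongr
              exact le_add_of_nonneg_right (abs_nonneg _)
          _ = _ := by ring)
    exact ⟨hg, hle.trans_eq (by ring)⟩
  choose hm hle using key
  refine ⟨LinearMap.mkContinuous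
    { toFun := fun H => mk _ (hm H)
      map_add' := fun H K => OrliczSpace.ext ?_
      map_smul' := fun c H => OrliczSpace.ext ?_ } _ hle, fun H => rfl⟩
  · simp only [toFn_mk, toFn_add]
    refine AEEqFun.ext ?_
    filter_upwards [AEEqFun.coeFn_mul (expFn U) (H.toFn + K.toFn),
      AEEqFun.coeFn_add H.toFn K.toFn, AEEqFun.coeFn_mul (expFn U) H.toFn,
      AEEqFun.coeFn_mul (expFn U) K.toFn,
      AEEqFun.coeFn_add (expFn U * H.toFn) (expFn U * K.toFn)] with x h1 h2 h3 h4 h5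
    rw [h1, h5, Pi.mul_apply, h2, Pi.add_apply, Pi.add_apply, h3, h4]
    simp only [Pi.mul_apply]
    ring
  · simp only [toFn_mk, toFn_smul, RingHom.id_apply]
    refine AEEqFun.ext ?_
    filter_upwards [AEEqFun.coeFn_mul (expFn U) (c • H.toFn), AEEqFun.coeFn_smul c H.toFn,
      AEEqFun.coeFn_smul c (expFn U * H.toFn), AEEqFun.coeFn_mul (expFn U) H.toFn]
      with x h1 h2 h3 h4
    rw [h1, h3, Pi.mul_apply, Pi.smul_apply, h2, h4]
    simp only [Pi.smul_apply, Pi.mul_apply, smul_eq_mul]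
    ring

theorem expFn_mem [IsProbabilityMeasure μ] {U : OrliczSpace coshSubOne μ}
    (hU : U ∈ expDomain μ) : expFn U ∈ orliczSubmodule coshSubOneConj μ := by
  obtain ⟨δ, C, hδ, hC, hmain⟩ := exists_norm_mk_le_of_abs_le_exp hU
  refine (hmain 0 0 (by simp) (by simp) 1 zero_le_one _ ?_).1
  filter_upwards [coeFn_expFn U] with x hx
  rw [hx, Real.abs_exp, one_mul]
  gcongr
  exact le_add_of_nonneg_right (by positivity)

open Classical in
/-- `e^U` as an element of the mixture space, with value `0` where it does not belong to it. -/
noncomputable def expMap (U : OrliczSpace coshSubOne μ) : OrliczSpace coshSubOneConj μ :=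
  if h : expFn U ∈ orliczSubmodule coshSubOneConj μ then mk (expFn U) h else 0

open Classical in
/-- The operator `H ↦ e^U H`, with value `0` where it is not bounded between the two spaces. -/
noncomputable def mulExp (U : OrliczSpace coshSubOne μ) :
    OrliczSpace coshSubOne μ →L[ℝ] OrliczSpace coshSubOneConj μ :=
  if h : ∃ A : OrliczSpace coshSubOne μ →L[ℝ] OrliczSpace coshSubOneConj μ,
    ∀ H, (A H).toFn = expFn U * H.toFn then h.choose else 0

theorem toFn_expMap [IsProbabilityMeasure μ] {U : OrliczSpace coshSubOne μ}
    (hU : U ∈ expDomain μ) : (expMap U).toFn = expFn U := by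
  rw [expMap, dif_pos (expFn_mem hU), toFn_mk]

theorem toFn_mulExp [IsProbabilityMeasure μ] {U : OrliczSpace coshSubOne μ}
    (hU : U ∈ expDomain μ) (H : OrliczSpace coshSubOne μ) :
    (mulExp U H).toFn = expFn U * H.toFn := by
  rw [mulExp, dif_pos (exists_mulExp hU)]
  exact (exists_mulExp hU).choose_spec H

end OrliczSpace

/-! ### Differentiability of the exponential map -/

namespace OrliczSpace

variable {Ω : Type*} [MeasurableSpace Ω] {μ : Measure Ω}

theorem eventually_two_mul_norm_sub_le {E : Type*} [NormedAddCommGroup E] (U : E) {d : ℝ}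
    (hd : 0 < d) : ∀ᶠ V in nhds U, 2 * ‖V - U‖ ≤ d := by
  filter_upwards [Metric.ball_mem_nhds U (half_pos hd)] with V hV
  have : ‖V - U‖ < d / 2 := by rwa [← dist_eq_norm]
  linarith

/-- The remainder of the first-order expansion of `e^V` at `U` is quadratic in `V - U`. -/
theorem exists_norm_expMap_sub_sub_le [IsProbabilityMeasure μ] {U : OrliczSpace coshSubOne μ}
    (hU : U ∈ expDomain μ) : ∃ C : ℝ, ∀ᶠ V in nhds U,
      ‖expMap V - expMap U - mulExp U (V - U)‖ ≤ C * ‖V - U‖ ^ 2 := by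
  obtain ⟨δ, C, hδ, hC, hmain⟩ := exists_norm_mk_le_of_abs_le_exp hU
  -- With `V - U = r k`, the available growth `e^{δ|k|}` is split as `(e^{δ|k|/4})² e^{δ|k|/2}`: the
  -- square absorbs `|k|²`, and the last factor absorbs `e^{|V - U|}` once `r ≤ δ / 2`.
  refine ⟨4 * ((δ / 4)⁻¹) ^ 2 * C, ?_⟩
  filter_upwards [expDomain_mem_nhds hU, eventually_two_mul_norm_sub_le U (half_pos hδ)]
    with V hV hr
  obtain ⟨k, hk, e⟩ := exists_eq_two_norm_smul (V - U)
  set r := 2 * ‖V - U‖ with hrdef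
  have hr0 : 0 ≤ r := by positivity
  have hs := coeFn_toFn_smul r k
  rw [← e] at hs
  obtain ⟨hg, hle⟩ := hmain k 0 hk (by simp) (r ^ 2 * ((δ / 4)⁻¹) ^ 2) (by positivity)
    (expMap V - expMap U - mulExp U (V - U)).toFn (by
      have h1 := coeFn_toFn_sub (expMap V - expMap U) (mulExp U (V - U))
      have h2 := coeFn_toFn_sub (expMap V) (expMap U)
      rw [toFn_mulExp hU] at h1
      rw [toFn_expMap hU, toFn_expMap hV] at h2
      filter_upwards [h1, h2, coeFn_toFn_sub V U, hs, coeFn_expFn U, coeFn_expFn V,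
        AEEqFun.coeFn_mul (expFn U) (V - U).toFn] with x h1 h2 h3 h4 h5 h6 h7
      rw [h1, h2, h7, Pi.mul_apply, h5, h6]
      set u := U.toFn x
      set z := (V - U).toFn x
      have hv : V.toFn x = u + z := by rw [h3]; ring
      rw [hv, Real.exp_add]
      have hz : |z| = r * |k.toFn x| := by rw [h4, abs_mul, abs_of_nonneg hr0]
      have hzδ : |z| ≤ δ / 2 * |k.toFn x| := by rw [hz]; gcongr
      calc |Real.exp u * Real.exp z - Real.exp u - Real.exp u * z|
          = Real.exp u * |Real.exp z - 1 - z| := by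
            rw [← Real.abs_exp u, ← abs_mul, Real.abs_exp]; congr 1; ring
        _ ≤ Real.exp u * (|z| ^ 2 * Real.exp |z|) := by
            gcongr; exact abs_exp_sub_one_sub_le_sq_mul_exp z
        _ ≤ Real.exp u * ((r * ((δ / 4)⁻¹ * Real.exp (δ / 4 * |k.toFn x|))) ^ 2 *
              Real.exp (δ / 2 * |k.toFn x|)) := by
            rw [hz] at hzδ ⊢
            gcongr
            exact le_inv_mul_exp_mul (by positivity) _
        _ = r ^ 2 * ((δ / 4)⁻¹) ^ 2 * Real.exp (u + δ * |k.toFn x|) := by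
            rw [mul_pow r, mul_pow (δ / 4)⁻¹, ← Real.exp_nat_mul]
            have : u + δ * |k.toFn x| =
              u + ((2 : ℕ) * (δ / 4 * |k.toFn x|) + δ / 2 * |k.toFn x|) := by push_cast; ring
            rw [this, Real.exp_add, Real.exp_add]; ring
        _ ≤ _ := by
            gcongr
            exact le_add_of_nonneg_right (abs_nonneg _))
  refine hle.trans_eq ?_
  rw [hrdef]; ring

theorem hasFDerivAt_expMap [IsProbabilityMeasure μ] {U : OrliczSpace coshSubOne μ}
    (hU : U ∈ expDomain μ) : HasFDerivAt expMap (mulExp U) U := by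
  obtain ⟨C, hC⟩ := exists_norm_expMap_sub_sub_le hU
  refine HasFDerivAt.of_isLittleO (Asymptotics.IsBigO.trans_isLittleO ?_
    (Asymptotics.isLittleO_pow_sub_sub U one_lt_two))
  refine Asymptotics.IsBigO.of_bound C ?_
  filter_upwards [hC] with V hV
  rwa [Real.norm_of_nonneg (by positivity)]

/-- The operator of multiplication by `e^V` depends on `V` in a locally Lipschitz way. -/
theorem exists_norm_mulExp_sub_le [IsProbabilityMeasure μ] {U : OrliczSpace coshSubOne μ}
    (hU : U ∈ expDomain μ) : ∃ C : ℝ, ∀ᶠ V in nhds U,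
      ‖mulExp V - mulExp U‖ ≤ C * ‖V - U‖ := by
  obtain ⟨δ, C, hδ, hC, hmain⟩ := exists_norm_mk_le_of_abs_le_exp hU
  -- With `V - U = r k`, half of the growth `e^{δ|k|}` absorbs `|k|` and the other half absorbs
  -- `e^{|V - U|}`, as `r ≤ δ / 2`; the direction `H` is absorbed by the second unit-ball function.
  refine ⟨4 * (δ / 2)⁻¹ * δ⁻¹ * C, ?_⟩
  filter_upwards [expDomain_mem_nhds hU, eventually_two_mul_norm_sub_le U (half_pos hδ)]
    with V hV hr
  refine ContinuousLinearMap.opNorm_le_bound _ (by positivity) fun H => ?_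
  obtain ⟨k, hk, e⟩ := exists_eq_two_norm_smul (V - U)
  obtain ⟨h, hh, eH⟩ := exists_eq_two_norm_smul H
  set r := 2 * ‖V - U‖ with hrdef
  have hr0 : 0 ≤ r := by positivity
  set s := 2 * ‖H‖ with hsdef
  have hs0 : 0 ≤ s := by positivity
  have hk' := coeFn_toFn_smul r k
  rw [← e] at hk'
  have hh' := coeFn_toFn_smul s h
  rw [← eH] at hh'
  obtain ⟨hg, hle⟩ := hmain k h hk hh (r * s * (δ / 2)⁻¹ * δ⁻¹) (by positivity)
    (mulExp V H - mulExp U H).toFn (by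
      have h1 := coeFn_toFn_sub (mulExp V H) (mulExp U H)
      rw [toFn_mulExp hU, toFn_mulExp hV] at h1
      filter_upwards [h1, coeFn_toFn_sub V U, hk', hh', coeFn_expFn U, coeFn_expFn V,
        AEEqFun.coeFn_mul (expFn U) H.toFn, AEEqFun.coeFn_mul (expFn V) H.toFn]
        with x h1 h3 h4 h5 h6 h7 h8 h9
      rw [h1, h8, h9, Pi.mul_apply, Pi.mul_apply, h6, h7]
      set u := U.toFn x
      set z := (V - U).toFn x
      have hv : V.toFn x = u + z := by rw [h3]; ring
      rw [hv, Real.exp_add]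
      have hz : |z| = r * |k.toFn x| := by rw [h4, abs_mul, abs_of_nonneg hr0]
      have hzδ : |z| ≤ δ / 2 * |k.toFn x| := by rw [hz]; gcongr
      have hH : |H.toFn x| = s * |h.toFn x| := by rw [h5, abs_mul, abs_of_nonneg hs0]
      calc |Real.exp u * Real.exp z * H.toFn x - Real.exp u * H.toFn x|
          = Real.exp u * |Real.exp z - 1| * |H.toFn x| := by
            rw [← Real.abs_exp u, ← abs_mul, ← abs_mul, Real.abs_exp]; congr 1; ring
        _ ≤ Real.exp u * (|z| * Real.exp |z|) * |H.toFn x| := by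
            gcongr; exact abs_exp_sub_one_le_abs_mul_exp z
        _ ≤ Real.exp u * ((r * ((δ / 2)⁻¹ * Real.exp (δ / 2 * |k.toFn x|))) *
              Real.exp (δ / 2 * |k.toFn x|)) * (s * (δ⁻¹ * Real.exp (δ * |h.toFn x|))) := by
            rw [hz] at hzδ ⊢
            rw [hH]
            gcongr
            · exact le_inv_mul_exp_mul (by positivity) _
            · exact le_inv_mul_exp_mul hδ _
        _ = _ := by
            have : u + δ * (|k.toFn x| + |h.toFn x|) = u + (δ / 2 * |k.toFn x| +
              (δ / 2 * |k.toFn x| + δ * |h.toFn x|)) := by ring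
            rw [this, Real.exp_add, Real.exp_add, Real.exp_add]; ring)
  rw [sub_apply]
  refine hle.trans_eq ?_
  rw [hrdef, hsdef]; ring

theorem continuousAt_mulExp [IsProbabilityMeasure μ] {U : OrliczSpace coshSubOne μ}
    (hU : U ∈ expDomain μ) : ContinuousAt mulExp U := by
  obtain ⟨C, hC⟩ := exists_norm_mulExp_sub_le hU
  refine tendsto_iff_norm_sub_tendsto_zero.2
    (squeeze_zero' (Filter.Eventually.of_forall fun _ => norm_nonneg _) hC ?_)
  have : ContinuousAt (fun V => C * ‖V - U‖) U := by fun_prop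
  simpa [ContinuousAt] using this

/-! ### The normalized exponential map -/

section Quotient

variable {E F : Type*} [NormedAddCommGroup E] [NormedSpace ℝ E] [NormedAddCommGroup F]
  [NormedSpace ℝ F]

theorem hasFDerivAt_inv_clm_smul (L : F →L[ℝ] ℝ) {G : E → F} {A : E →L[ℝ] F} {U : E}
    (hG : HasFDerivAt G A U) (hne : L (G U) ≠ 0) :
    HasFDerivAt (fun V => (L (G V))⁻¹ • G V)
      ((L (G U))⁻¹ • A + (-((L (G U)) ^ 2)⁻¹ • L.comp A).smulRight (G U)) U := by
  have hL : HasFDerivAt (fun V => L (G V)) (L.comp A) U := L.hasFDerivAt.comp U hG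
  exact ((hasDerivAt_inv hne).comp_hasFDerivAt U hL).smul hG

theorem continuousAt_inv_clm_smul_deriv (L : F →L[ℝ] ℝ) {G : E → F} {A : E → E →L[ℝ] F} {U : E}
    (hG : ContinuousAt G U) (hA : ContinuousAt A U) (hne : L (G U) ≠ 0) :
    ContinuousAt (fun V => (L (G V))⁻¹ • A V +
      (-((L (G V)) ^ 2)⁻¹ • L.comp (A V)).smulRight (G V)) U := by
  have hZ : ContinuousAt (fun V => L (G V)) U := L.continuous.continuousAt.comp hG
  have hL : ContinuousAt (fun V => L.comp (A V)) U := continuousAt_const.clm_comp hA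
  have hc := ((hZ.pow 2).inv₀ (pow_ne_zero 2 hne)).neg.smul hL
  refine ((hZ.inv₀ hne).smul hA).add ?_
  exact (isBoundedBilinearMap_smulRight (𝕜 := ℝ)).continuous.continuousAt.comp
    (hc.prodMk hG)

end Quotient

/-- The normalized density `e^U / ∫ e^U` as an element of the mixture space. It is meaningful where
`e^U` belongs to that space, in particular on `expDomain`. -/
noncomputable def normExpMap [IsProbabilityMeasure μ] (U : OrliczSpace coshSubOne μ) :
    OrliczSpace coshSubOneConj μ :=
  (integralCLM coshSubOneConj μ (expMap U))⁻¹ • expMap U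

/-- The derivative of `normExpMap`, in the form given by the product rule. -/
noncomputable def normExpMapDeriv [IsProbabilityMeasure μ] (U : OrliczSpace coshSubOne μ) :
    OrliczSpace coshSubOne μ →L[ℝ] OrliczSpace coshSubOneConj μ :=
  (integralCLM coshSubOneConj μ (expMap U))⁻¹ • mulExp U +
    (-((integralCLM coshSubOneConj μ (expMap U)) ^ 2)⁻¹ •
      (integralCLM coshSubOneConj μ).comp (mulExp U)).smulRight (expMap U)

theorem integral_expMap [IsProbabilityMeasure μ] {U : OrliczSpace coshSubOne μ}
    (hU : U ∈ expDomain μ) :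
    Integrable (fun x => Real.exp (U.toFn x)) μ ∧
      integralCLM coshSubOneConj μ (expMap U) = ∫ x, Real.exp (U.toFn x) ∂μ := by
  have h : (expMap U).toFn =ᵐ[μ] fun x => Real.exp (U.toFn x) := by
    rw [toFn_expMap hU]; exact coeFn_expFn U
  exact ⟨(integrable_and_abs_integral_le (expMap U)).1.congr h, integral_congr_ae h⟩

theorem integralCLM_expMap_pos [IsProbabilityMeasure μ] {U : OrliczSpace coshSubOne μ}
    (hU : U ∈ expDomain μ) : 0 < integralCLM coshSubOneConj μ (expMap U) := by
  rw [(integral_expMap hU).2]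
  exact integral_exp_pos (integral_expMap hU).1

theorem hasFDerivAt_normExpMap [IsProbabilityMeasure μ] {U : OrliczSpace coshSubOne μ}
    (hU : U ∈ expDomain μ) : HasFDerivAt normExpMap (normExpMapDeriv U) U :=
  hasFDerivAt_inv_clm_smul (integralCLM coshSubOneConj μ) (hasFDerivAt_expMap hU)
    (integralCLM_expMap_pos hU).ne'

theorem continuousAt_normExpMapDeriv [IsProbabilityMeasure μ]
    {U : OrliczSpace coshSubOne μ} (hU : U ∈ expDomain μ) :
    ContinuousAt normExpMapDeriv U :=
  continuousAt_inv_clm_smul_deriv (integralCLM coshSubOneConj μ)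
    (hasFDerivAt_expMap hU).continuousAt (continuousAt_mulExp hU)
    (integralCLM_expMap_pos hU).ne'

/-- The covariance form of the derivative of the normalized exponential map. -/
theorem coeFn_normExpMapDeriv [IsProbabilityMeasure μ] {U : OrliczSpace coshSubOne μ}
    (hU : U ∈ expDomain μ) (H : OrliczSpace coshSubOne μ) :
    Integrable (fun x => Real.exp (U.toFn x) * H.toFn x) μ ∧
    (normExpMapDeriv U H).toFn =ᵐ[μ] fun x =>
      (∫ y, Real.exp (U.toFn y) ∂μ)⁻¹ * Real.exp (U.toFn x) * (H.toFn x -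
        (∫ y, Real.exp (U.toFn y) ∂μ)⁻¹ * ∫ y, Real.exp (U.toFn y) * H.toFn y ∂μ) := by
  have hm : (mulExp U H).toFn =ᵐ[μ] fun x => Real.exp (U.toFn x) * H.toFn x := by
    rw [toFn_mulExp hU]
    filter_upwards [AEEqFun.coeFn_mul (expFn U) H.toFn, coeFn_expFn U] with x h1 h2
    rw [h1, Pi.mul_apply, h2]
  refine ⟨(integrable_and_abs_integral_le (mulExp U H)).1.congr hm, ?_⟩
  have e : normExpMapDeriv U H = (∫ y, Real.exp (U.toFn y) ∂μ)⁻¹ • mulExp U H +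
      (-((∫ y, Real.exp (U.toFn y) ∂μ) ^ 2)⁻¹ *
        ∫ y, Real.exp (U.toFn y) * H.toFn y ∂μ) • expMap U := by
    rw [← (integral_expMap hU).2, ← integral_congr_ae hm]
    rfl
  rw [e]
  have hG : (expMap U).toFn =ᵐ[μ] fun x => Real.exp (U.toFn x) := by
    rw [toFn_expMap hU]; exact coeFn_expFn U
  filter_upwards [coeFn_toFn_add ((∫ y, Real.exp (U.toFn y) ∂μ)⁻¹ • mulExp U H)
    ((-((∫ y, Real.exp (U.toFn y) ∂μ) ^ 2)⁻¹ *
        ∫ y, Real.exp (U.toFn y) * H.toFn y ∂μ) • expMap U),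
    coeFn_toFn_smul (∫ y, Real.exp (U.toFn y) ∂μ)⁻¹ (mulExp U H),
    coeFn_toFn_smul (-((∫ y, Real.exp (U.toFn y) ∂μ) ^ 2)⁻¹ *
        ∫ y, Real.exp (U.toFn y) * H.toFn y ∂μ) (expMap U), hm, hG] with x h1 h2 h3 h4 h5
  rw [h1, h2, h3, h4, h5]
  ring

end OrliczSpace

/-! ### The Gaussian case -/

section Gaussian

open OrliczSpace

variable {n : ℕ}

theorem KM_lt_top_iff (U : LexpM n) :
    KM U < ⊤ ↔ Integrable (fun x => Real.exp (U.toFn x)) (gaussM n) := by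
  have hm : Measurable fun x => Real.exp (U.toFn x) :=
    Real.measurable_exp.comp U.toFn.measurable
  rw [KM, ENNReal.log_lt_top_iff, ZM, Integrable, and_iff_right hm.aestronglyMeasurable,
    hasFiniteIntegral_iff_ofReal (Filter.Eventually.of_forall fun x => (Real.exp_pos _).le)]

/-- If the domain of `K_M` is a neighbourhood of `U` along the line through `U` and `0`, then it
contains `p U` for some `p > 1`. -/
theorem mem_expDomain_of_eventually {U : LexpM n}
    (h : ∀ᶠ t : ℝ in nhds 1, KM (t • U) < ⊤) : U ∈ expDomain (gaussM n) := by
  obtain ⟨p, hp, hp1⟩ := ((h.filter_mono nhdsWithin_le_nhds).and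
    (self_mem_nhdsWithin : ∀ᶠ t : ℝ in nhdsWithin 1 (Set.Ioi 1), t ∈ Set.Ioi (1 : ℝ))).exists
  refine ⟨p, hp1, ((KM_lt_top_iff _).1 hp).congr ?_⟩
  filter_upwards [coeFn_toFn_smul p U] with x hx
  rw [hx]

theorem SMexp_subset_expDomain : SMexp n ⊆ expDomain (gaussM n) := by
  intro U hU
  refine mem_expDomain_of_eventually ?_
  have hc : ContinuousAt (fun t : ℝ => t • U) 1 := by fun_prop
  refine hc.eventually (p := fun V => KM V < ⊤) ?_
  simp only [one_smul]
  exact mem_interior_iff_mem_nhds.1 hU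

theorem coe_mem_expDomain_of_mem_SM {U : BM n} (hU : U ∈ SM n) :
    (U : LexpM n) ∈ expDomain (gaussM n) := by
  refine mem_expDomain_of_eventually ?_
  have hc : ContinuousAt (fun t : ℝ => t • U) 1 := by fun_prop
  refine hc.eventually (p := fun V : BM n => KM (V : LexpM n) < ⊤) ?_
  simp only [one_smul]
  exact mem_interior_iff_mem_nhds.1 hU

theorem coeFn_eM {U : LexpM n} (hU : U ∈ expDomain (gaussM n)) :
    eM U =ᵐ[gaussM n] fun x =>
      (∫ y, Real.exp (U.toFn y) ∂gaussM n)⁻¹ * Real.exp (U.toFn x) := by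
  have hI := (integral_expMap hU).1
  have hpos : 0 < ∫ y, Real.exp (U.toFn y) ∂gaussM n := integral_exp_pos hI
  have hZ : ZM U = ENNReal.ofReal (∫ y, Real.exp (U.toFn y) ∂gaussM n) :=
    (ofReal_integral_eq_lintegral_ofReal hI
      (Filter.Eventually.of_forall fun x => (Real.exp_pos _).le)).symm
  have hK : (KM U).toReal = Real.log (∫ y, Real.exp (U.toFn y) ∂gaussM n) := by
    rw [KM, hZ, ENNReal.log_pos_real (by simpa using hpos) ENNReal.ofReal_ne_top,
      ENNReal.toReal_ofReal hpos.le, EReal.toReal_coe]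
  have := AEEqFun.coeFn_comp (fun t : ℝ => Real.exp (t - (KM U).toReal)) (by fun_prop) U.toFn
  filter_upwards [this] with x hx
  rw [eM, hx, Function.comp_apply, hK, Real.exp_sub, Real.exp_log hpos, div_eq_inv_mul]

theorem toFn_normExpMap_eq_eM {U : LexpM n} (hU : U ∈ expDomain (gaussM n)) :
    (normExpMap U).toFn = eM U := by
  refine AEEqFun.ext ?_
  have hG : (expMap U).toFn =ᵐ[gaussM n] fun x => Real.exp (U.toFn x) := by
    rw [toFn_expMap hU]; exact coeFn_expFn U
  filter_upwards [coeFn_toFn_smul (integralCLM coshSubOneConj (gaussM n) (expMap U))⁻¹ (expMap U),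
    hG, coeFn_eM hU] with x h1 h2 h3
  rw [normExpMap, h1, h2, h3, (integral_expMap hU).2]

theorem coeFn_toReal_ofReal_eM_smul {U : LexpM n} (hU : U ∈ expDomain (gaussM n))
    (H : LexpM n) : (fun x => (ENNReal.ofReal (eM U x)).toReal • H.toFn x) =ᵐ[gaussM n] fun x =>
      (∫ y, Real.exp (U.toFn y) ∂gaussM n)⁻¹ * (Real.exp (U.toFn x) * H.toFn x) := by
  have hpos : 0 < ∫ y, Real.exp (U.toFn y) ∂gaussM n := integral_exp_pos (integral_expMap hU).1
  filter_upwards [coeFn_eM hU] with x hx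
  rw [hx, ENNReal.toReal_ofReal (by positivity), smul_eq_mul, mul_assoc]

theorem integrable_eMMeasure {U : LexpM n} (hU : U ∈ expDomain (gaussM n)) (H : LexpM n) :
    Integrable H.toFn (eMMeasure U) := by
  rw [eMMeasure, integrable_withDensity_iff_integrable_smul' (eM U).measurable.ennreal_ofReal
    (Filter.Eventually.of_forall fun x => ENNReal.ofReal_lt_top)]
  exact ((coeFn_normExpMapDeriv hU H).1.const_mul _).congr (coeFn_toReal_ofReal_eM_smul hU H).symm

theorem integral_eMMeasure {U : LexpM n} (hU : U ∈ expDomain (gaussM n)) (H : LexpM n) :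
    ∫ x, H.toFn x ∂eMMeasure U = (∫ y, Real.exp (U.toFn y) ∂gaussM n)⁻¹ *
      ∫ y, Real.exp (U.toFn y) * H.toFn y ∂gaussM n := by
  rw [eMMeasure, integral_withDensity_eq_integral_toReal_smul (eM U).measurable.ennreal_ofReal
    (Filter.Eventually.of_forall fun x => ENNReal.ofReal_lt_top),
    integral_congr_ae (coeFn_toReal_ofReal_eM_smul hU H), integral_const_mul]

theorem toFn_normExpMapDeriv_eq {U : LexpM n} (hU : U ∈ expDomain (gaussM n)) (H : LexpM n) :
    (normExpMapDeriv U H).toFn =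
      eM U * (H.toFn - AEEqFun.const _ (∫ x, H.toFn x ∂eMMeasure U)) := by
  refine AEEqFun.ext ?_
  set c := ∫ x, H.toFn x ∂eMMeasure U with hc
  filter_upwards [(coeFn_normExpMapDeriv hU H).2, coeFn_eM hU,
    AEEqFun.coeFn_mul (eM U) (H.toFn - AEEqFun.const _ c),
    AEEqFun.coeFn_sub H.toFn (AEEqFun.const _ c),
    AEEqFun.coeFn_const (μ := gaussM n) (α := EuclideanSpace ℝ (Fin n)) c] with x h1 h2 h3 h4 h5
  rw [h1, h3, Pi.mul_apply, h4, Pi.sub_apply, h5, h2, hc, integral_eMMeasure hU]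
  rfl

end Gaussian

theorem mainTheorem1 (n : ℕ) :
    (∃ (F : BM n → LlogLM n) (D : BM n → (BM n →L[ℝ] LlogLM n)),
      (∀ U ∈ SM n, (F U).toFn = eM (U : LexpM n)) ∧
      (∀ U ∈ SM n, HasFDerivAt F (D U) U) ∧
      ContinuousOn D (SM n) ∧
      (∀ U ∈ SM n, ∀ H : BM n,
        Integrable (H : LexpM n).toFn (eMMeasure (U : LexpM n)) ∧
        (D U H).toFn = eM (U : LexpM n) * ((H : LexpM n).toFn -
          AEEqFun.const _ (∫ x, (H : LexpM n).toFn x ∂eMMeasure (U : LexpM n))))) ∧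
    (∃ (F : LexpM n → LlogLM n) (D : LexpM n → (LexpM n →L[ℝ] LlogLM n)),
      (∀ U ∈ SMexp n, (F U).toFn = eM U) ∧
      (∀ U ∈ SMexp n, HasFDerivAt F (D U) U) ∧
      ContinuousOn D (SMexp n) ∧
      (∀ U ∈ SMexp n, ∀ H : LexpM n,
        Integrable H.toFn (eMMeasure U) ∧
        (D U H).toFn = eM U * (H.toFn - AEEqFun.const _ (∫ x, H.toFn x ∂eMMeasure U)))) := by
  refine ⟨⟨fun U => OrliczSpace.normExpMap (U : LexpM n),
    fun U => (OrliczSpace.normExpMapDeriv (U : LexpM n)).comp (BM n).subtypeL,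
    fun U hU => toFn_normExpMap_eq_eM (coe_mem_expDomain_of_mem_SM hU), fun U hU => ?_,
    fun U hU => ?_, fun U hU H =>
      ⟨integrable_eMMeasure (coe_mem_expDomain_of_mem_SM hU) _,
        toFn_normExpMapDeriv_eq (coe_mem_expDomain_of_mem_SM hU) _⟩⟩,
    OrliczSpace.normExpMap, OrliczSpace.normExpMapDeriv,
    fun U hU => toFn_normExpMap_eq_eM (SMexp_subset_expDomain hU),
    fun U hU => OrliczSpace.hasFDerivAt_normExpMap (SMexp_subset_expDomain hU),
    fun U hU => (OrliczSpace.continuousAt_normExpMapDeriv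
      (SMexp_subset_expDomain hU)).continuousWithinAt,
    fun U hU H => ⟨integrable_eMMeasure (SMexp_subset_expDomain hU) H,
      toFn_normExpMapDeriv_eq (SMexp_subset_expDomain hU) H⟩⟩
  · exact (OrliczSpace.hasFDerivAt_normExpMap (coe_mem_expDomain_of_mem_SM hU)).comp U
      (BM n).subtypeL.hasFDerivAt
  · have h1 : ContinuousAt (fun V : BM n => OrliczSpace.normExpMapDeriv (V : LexpM n)) U :=
      ContinuousAt.comp (f := fun V : BM n => (V : LexpM n))
        (OrliczSpace.continuousAt_normExpMapDeriv (coe_mem_expDomain_of_mem_SM hU))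
        continuous_subtype_val.continuousAt
    exact (h1.clm_comp continuousAt_const).continuousWithinAt
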